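/- Let $K$ be a nonarchimedean local field of characteristic $p>0$ (a non-discrete, totally disconnected, locally compact topological field), with absolute value $|\cdot|$, ring of integers $\mathfrak D=\{x:|x|\le 1\}$, prime ideal $\mathfrak P=\{x:|x|<1\}$ and residue field $\mathfrak D/\mathfrak P$ of cardinality $q=p^c$. Let $L^2(K)$ be the space of complex square-integrable functions for the Haar measure $dx$ of $K^+$ normalized by $\int_{\mathfrak D}dx=1$. Fix an element $\mathfrak p$ of maximal absolute value in $\mathfrak P$ (a prime element), and units $1=\epsilon_0,\epsilon_1,\dots,\epsilon_{c-1}$ of $\mathfrak D$ whose residues form a basis of $\mathfrak D/\mathfrak P$ over $GF(p)$. For $0\le n<q$ with $n=a_0+a_1p+\cdots+a_{c-1}p^{c-1}$, $0\le a_i<p$, put $u(n)=(a_0+a_1\epsilon_1+\cdots+a_{c-1}\epsilon_{c-1})\mathfrak p^{-1}$, and for general $n=b_0+b_1q+\cdots+b_sq^s$, $0\le b_i<q$, put $u(n)=u(b_0)+u(b_1)\mathfrak p^{-1}+\cdots+u(b_s)\mathfrak p^{-s}$. For $y\in K$, $j\in\mathbb Z$ and $f\in L^2(K)$ let $\tau_yf(x)=f(x-y)$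 and $\delta_jf(x)=q^{j/2}f(\mathfrak p^{-j}x)$. A family $(e_i)_{i\in I}$ in $L^2(K)$ is a frame if there are constants $0<A\le B<\infty$ with $$A\|f\|_2^2\le\sum_{i\in I}|\langle f,e_i\rangle|^2\le B\|f\|_2^2\qquad\text{for all } f\in L^2(K).$$ **Theorem.** For every finite $\Psi=\{\psi^1,\dots,\psi^L\}\subset L^2(K)$ and all complex scalars $c_{l,j}$ ($1\le l\le L$, $j\in\mathbb Z$), the weighted co-affine system $$X^*(\Psi,c)=\{c_{l,j}\,\tau_{u(k)}\delta_j\psi^l : 1\le l\le L,\ j\in\mathbb Z,\ k=0,1,2,\dots\}$$ is not a frame for $L^2(K)$. This holds both when $X^*(\Psi,c)$ is regarded as a family indexed by $(l,j,k)$ and when it is regarded as the set of its distinct elements. -/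

import Mathlib

open ValuativeRel MeasureTheory
open scoped NNReal ENNReal

/-! Wavelet-type systems on a nonarchimedean local field `K`. Here `𝒪[K]` is the ring of integers
`{x | |x| ≤ 1}` and `𝓀[K]` is its (finite) residue field. -/

namespace LocalFieldFrames

section Field

variable (K : Type*) [Field K] [ValuativeRel K] [TopologicalSpace K]

/-- The cardinality `q` of the residue field. -/
noncomputable def resCard : ℕ := Nat.card 𝓀[K]

variable {K}

/-- A prime element of `K`: an element of maximal absolute value in `{x | |x| < 1}`. -/
def IsPrimeElement (ϖ : K) : Prop :=
  valuation K ϖ < 1 ∧ ∀ y : K, valuation K y < 1 → valuation K y ≤ valuation K ϖ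

theorem IsPrimeElement.ne_zero [IsNonarchimedeanLocalField K] {ϖ : K} (h : IsPrimeElement ϖ) :
    ϖ ≠ 0 := by
  rintro rfl
  obtain ⟨y, hy0, hy1⟩ := Valuation.IsNontrivial.exists_lt_one (v := valuation K)
  have := h.2 y hy1
  simp only [map_zero, nonpos_iff_eq_zero] at this
  exact hy0 ((map_eq_zero _).1 this)

/-- `ε 0 = 1, ε 1, …, ε (c - 1)` are units of `𝒪[K]` and `q = p ^ c`, and the residues of the
`ε i` span the residue field. The span over the prime field `GF(p)` is the additive subgroup
generated by the residues; as there are `c` of them, they form a basis over `GF(p)`. -/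
structure IsResidueBasis (p : ℕ) {c : ℕ} (ε : Fin c → 𝒪[K]) : Prop where
  card_eq : resCard K = p ^ c
  eq_one : ∀ i : Fin c, (i : ℕ) = 0 → ε i = 1
  isUnit : ∀ i, IsUnit (ε i)
  span_eq : AddSubgroup.closure (Set.range fun i => IsLocalRing.residue 𝒪[K] (ε i)) = ⊤

/-- For `0 ≤ n < q` with base-`p` expansion `n = a₀ + a₁ p + ⋯ + a_{c-1} p ^ (c - 1)`, this is
`(a₀ ε₀ + a₁ ε₁ + ⋯ + a_{c-1} ε_{c-1}) ϖ⁻¹`. -/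
noncomputable def uDigit (p : ℕ) {c : ℕ} (ε : Fin c → 𝒪[K]) (ϖ : K) (n : ℕ) : K :=
  (∑ i : Fin c, ((n / p ^ (i : ℕ) % p : ℕ) : K) * (ε i : K)) * ϖ⁻¹

/-- For `n` with base-`q` expansion `n = b₀ + b₁ q + ⋯ + b_s q ^ s`, this is
`u(b₀) + u(b₁) ϖ⁻¹ + ⋯ + u(b_s) ϖ ^ (-s)`. The digits of `n` with index greater than `n` vanish
(since `q ≥ 2`, so `n < q ^ n`), so that the sum can be taken over `0 ≤ k ≤ n`. -/
noncomputable def u (p : ℕ) {c : ℕ} (ε : Fin c → 𝒪[K]) (ϖ : K) (n : ℕ) : K :=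
  ∑ k ∈ Finset.range (n + 1), uDigit p ε ϖ (n / resCard K ^ k % resCard K) * ϖ⁻¹ ^ k

end Field

section L2

variable (K : Type*) [Field K] [ValuativeRel K] [TopologicalSpace K]
  [IsNonarchimedeanLocalField K]

/-- The ring of integers as a compact set with nonempty interior. -/
def integerCompacts : TopologicalSpace.PositiveCompacts K where
  carrier := {x : K | valuation K x ≤ 1}
  isCompact' := IsNonarchimedeanLocalField.isCompact_closedBall K 1
  interior_nonempty' := by
    have hopen : IsOpen {x : K | valuation K x ≤ 1} :=
      by simpa [Valuation.restrict_le_one_iff] using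
        Valuation.isOpen_closedBall (v := valuation K) one_ne_zero
    refine ⟨0, ?_⟩
    rw [hopen.interior_eq]
    simp

variable [MeasurableSpace K] [BorelSpace K]

/-- The Haar measure of the additive group of `K`, normalized so that `𝒪[K]` has measure `1`. -/
noncomputable def haar : Measure K := Measure.addHaarMeasure (integerCompacts K)

instance : (haar K).IsAddHaarMeasure :=
  inferInstanceAs (Measure.addHaarMeasure (integerCompacts K)).IsAddHaarMeasure

instance : (haar K).Regular :=
  inferInstanceAs (Measure.addHaarMeasure (integerCompacts K)).Regular

theorem haar_integer : haar K {x : K | valuation K x ≤ 1} = 1 :=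
  Measure.addHaarMeasure_self

/-- The complex Hilbert space `L²(K)`. -/
abbrev L2 : Type _ := Lp ℂ 2 (haar K)

variable {K}

/-- The translation operator `(τ_y f)(x) = f (x - y)` on `L²(K)`. -/
noncomputable def translation (y : K) (f : L2 K) : L2 K :=
  Lp.compMeasurePreserving (fun x => x - y) (measurePreserving_sub_right (haar K) y) f

theorem memLp_comp_mul_left {a : K} (ha : a ≠ 0) {f : K → ℂ} (hf : MemLp f 2 (haar K)) :
    MemLp (fun x => f (a * x)) 2 (haar K) := by
  have hcont : Continuous fun x : K => a * x := continuous_const_mul a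
  have hcont' : Continuous fun x : K => a⁻¹ * x := continuous_const_mul a⁻¹
  let φ : K ≃ₜ+ K :=
    { toFun := fun x => a * x
      invFun := fun x => a⁻¹ * x
      left_inv := fun x => by simp [ha]
      right_inv := fun x => by simp [ha]
      map_add' := fun x y => mul_add a x y
      continuous_toFun := hcont
      continuous_invFun := hcont' }
  have hreg : (Measure.map (fun x : K => a * x) (haar K)).Regular :=
    Measure.Regular.map φ.toHomeomorph
  have hhaar : (Measure.map (fun x : K => a * x) (haar K)).IsAddHaarMeasure :=
    φ.isAddHaarMeasure_map (haar K)
  have h := Measure.isAddLeftInvariant_eq_smul_of_regular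
    (Measure.map (fun x : K => a * x) (haar K)) (haar K)
  refine MemLp.comp_of_map (g := f) (f := fun x : K => a * x) ?_ hcont.measurable.aemeasurable
  rw [h]
  exact hf.smul_measure ENNReal.coe_ne_top

theorem memLp_dilation {ϖ : K} (hϖ : IsPrimeElement ϖ) (j : ℤ) (f : L2 K) :
    MemLp (fun x => (((resCard K : ℝ) ^ ((j : ℝ) / 2) : ℝ) : ℂ) * f (ϖ ^ (-j) * x)) 2 (haar K) :=
  (memLp_comp_mul_left (zpow_ne_zero (-j) hϖ.ne_zero) (Lp.memLp f)).const_mul _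

/-- The dilation operator `(δ_j f)(x) = q ^ (j / 2) f (ϖ ^ (-j) x)` on `L²(K)`. -/
noncomputable def dilation {ϖ : K} (hϖ : IsPrimeElement ϖ) (j : ℤ) (f : L2 K) : L2 K :=
  (memLp_dilation hϖ j f).toLp _

/-- The weighted co-affine system `c_{l,j} τ_{u(k)} δ_j ψ^l`, with `1 ≤ l ≤ L`, `j ∈ ℤ`,
`k = 0, 1, 2, …`, as an indexed family. -/
noncomputable def coaffineSystem (p : ℕ) {c : ℕ} (ε : Fin c → 𝒪[K]) {ϖ : K}
    (hϖ : IsPrimeElement ϖ) {L : ℕ} (ψ : Fin L → L2 K) (w : Fin L → ℤ → ℂ) :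
    Fin L × ℤ × ℕ → L2 K :=
  fun i => w i.1 i.2.1 • translation (u p ε ϖ i.2.2) (dilation hϖ i.2.1 (ψ i.1))

end L2

/-- A family `(e i)` in a complex Hilbert space is a frame: there are constants `0 < A ≤ B < ∞`
with `A ‖f‖² ≤ ∑ |⟨f, e i⟩|² ≤ B ‖f‖²` for all `f`. -/
def IsFrame {H : Type*} [NormedAddCommGroup H] [InnerProductSpace ℂ H] {ι : Type*}
    (e : ι → H) : Prop :=
  ∃ A B : ℝ≥0, 0 < A ∧ A ≤ B ∧ ∀ f : H,
    (A : ℝ≥0∞) * ‖f‖ₑ ^ 2 ≤ ∑' i, ‖inner ℂ f (e i)‖ₑ ^ 2 ∧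
    ∑' i, ‖inner ℂ f (e i)‖ₑ ^ 2 ≤ (B : ℝ≥0∞) * ‖f‖ₑ ^ 2

end LocalFieldFrames

namespace LocalFieldFrames

/-! The weights are harmless because only the norms of the system enter. Testing the upper frame
bound on an element `e i` itself gives `‖e i‖² ≤ B`. The lower bound is then violated by many test
functions at once. Take the mean-zero bumps `wave (ϖ ^ N)` translated by `ϖ ^ t`, for `t < N`.
Moving `τ_{u(k)} δ_j` to the other side of the inner product turns the `t`-th bump into a multiple
of `x ↦ wave (ϖ ^ N) (ϖ ^ j x - (ϖ ^ t - u(k)))`.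

After normalization these functions are orthonormal in all three indices `(t, j, k)` jointly
(`orthonormal_waveFamily`). For equal `j` the supports are disjoint, because the points `ϖ ^ t -
u(k)` are more than `|ϖ ^ N|` apart. For different `j` the coarser function is constant on the
support of the finer one, which has integral zero. Bessel's inequality for each normalized `ψ l`
bounds the frame sums, added over all `t < N`, by `L B η²`, where `η` is the common norm of the
bumps (`sum_tsum_inner_coaffineSystem_le`). The lower bound makes the same total at least `N A η²`,
which is impossible for large `N`. -/

theorem eq_of_digits_eq {q : ℕ} (hq : 2 ≤ q) {m n : ℕ}
    (h : ∀ k, m / q ^ k % q = n / q ^ k % q) : m = n := by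
  induction m using Nat.strong_induction_on generalizing n with
  | _ m ih =>
    have h0 : m % q = n % q := by simpa using h 0
    have hdiv : ∀ k, m / q / q ^ k % q = n / q / q ^ k % q := fun k => by
      simpa [Nat.div_div_eq_div_mul, pow_succ'] using h (k + 1)
    have hmn : m / q = n / q := by
      rcases Nat.eq_zero_or_pos m with rfl | hm
      · by_contra hne
        have hn : n ≠ 0 := by rintro rfl; simp at hne
        have hlog := h (Nat.log q n)
        have h1 : n / q ^ Nat.log q n < q := by
          rw [Nat.div_lt_iff_lt_mul (by positivity), ← pow_succ']
          exact Nat.lt_pow_succ_log_self hq n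
        have h2 : 0 < n / q ^ Nat.log q n :=
          Nat.div_pos (Nat.pow_log_le_self q hn) (by positivity)
        rw [Nat.mod_eq_of_lt h1] at hlog
        simp at hlog
        omega
      · exact ih _ (Nat.div_lt_self hm hq) hdiv
    rw [← Nat.div_add_mod m q, ← Nat.div_add_mod n q, hmn, h0]

/-! ### The points `u(n)` lie in distinct cosets of `𝒪[K]`. -/

section Field

variable {K : Type*} [Field K] [ValuativeRel K]

/-- The integral combination `a₀ ε₀ + ⋯ + a_{c-1} ε_{c-1}` attached to the base-`p` digits of `n`. -/
noncomputable def digitSum (p : ℕ) {c : ℕ} (ε : Fin c → 𝒪[K]) (n : ℕ) : 𝒪[K] :=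
  ∑ i : Fin c, ((n / p ^ (i : ℕ) % p : ℕ) : 𝒪[K]) * ε i

theorem valuation_sub_eq_one_of_residue_ne {x y : 𝒪[K]}
    (h : IsLocalRing.residue 𝒪[K] x ≠ IsLocalRing.residue 𝒪[K] y) :
    valuation K ((x : K) - y) = 1 := by
  have hu : IsUnit (x - y) := by
    rw [← IsLocalRing.residue_ne_zero_iff_isUnit, map_sub]
    exact sub_ne_zero.2 h
  have := (Valuation.Integers.isUnit_iff_valuation_eq_one
    (Valuation.integer.integers (valuation K))).1 hu
  exact this

/-- By the ultrametric inequality, the last nonzero term dominates the sum. The first conjunct is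
what carries the induction: it keeps the earlier terms strictly below the next one. -/
theorem one_lt_valuation_sum {ϖ : K} (hϖ0 : ϖ ≠ 0) (hϖ : valuation K ϖ < 1) {a : ℕ → K}
    (ha : ∀ k, a k = 0 ∨ valuation K (a k) = 1) (M : ℕ) :
    valuation K (∑ k ∈ Finset.range M, a k * ϖ⁻¹ ^ (k + 1)) ≤ valuation K ϖ⁻¹ ^ M ∧
    ((∀ k < M, a k = 0) ∨
      1 < valuation K (∑ k ∈ Finset.range M, a k * ϖ⁻¹ ^ (k + 1))) := by
  have h1 : 1 < valuation K ϖ⁻¹ := by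
    rw [map_inv₀]
    exact (one_lt_inv₀ (by simpa [zero_lt_iff] using hϖ0)).2 hϖ
  induction M with
  | zero => simp
  | succ M ih =>
    rw [Finset.sum_range_succ]
    have hlt : valuation K ϖ⁻¹ ^ M < valuation K ϖ⁻¹ ^ (M + 1) :=
      pow_lt_pow_right₀ h1 (Nat.lt_succ_self M)
    rcases ha M with h | h
    · simp only [h, zero_mul, add_zero]
      refine ⟨ih.1.trans hlt.le, ih.2.imp (fun h' k hk => ?_) id⟩
      rcases Nat.lt_succ_iff_lt_or_eq.1 hk with hk | rfl
      exacts [h' k hk, h]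
    · have hv : valuation K (a M * ϖ⁻¹ ^ (M + 1)) = valuation K ϖ⁻¹ ^ (M + 1) := by
        rw [map_mul, h, one_mul, map_pow]
      have := Valuation.map_add_eq_of_lt_right (valuation K)
        ((ih.1.trans_lt hlt).trans_eq hv.symm)
      rw [this, hv]
      exact ⟨le_rfl, Or.inr (one_lt_pow₀ h1 (Nat.succ_ne_zero M))⟩

theorem uDigit_eq (p : ℕ) {c : ℕ} (ε : Fin c → 𝒪[K]) (ϖ : K) (n : ℕ) :
    uDigit p ε ϖ n = (digitSum p ε n : K) * ϖ⁻¹ := by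
  simp [uDigit, digitSum]

theorem u_eq_sum (p : ℕ) {c : ℕ} (ε : Fin c → 𝒪[K]) (ϖ : K) (hq : 2 ≤ resCard K) {n M : ℕ}
    (hM : n < M) :
    u p ε ϖ n = ∑ k ∈ Finset.range M,
      (digitSum p ε (n / resCard K ^ k % resCard K) : K) * ϖ⁻¹ ^ (k + 1) := by
  have h : ∀ k, uDigit p ε ϖ (n / resCard K ^ k % resCard K) * ϖ⁻¹ ^ k =
      (digitSum p ε (n / resCard K ^ k % resCard K) : K) * ϖ⁻¹ ^ (k + 1) := fun k => by
    rw [uDigit_eq, pow_succ']; ring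
  rw [u, Finset.sum_congr rfl fun k _ => h k]
  refine Finset.sum_subset (Finset.range_mono hM) fun k _ hk => ?_
  have hk' : n < k := by simpa using hk
  have : n / resCard K ^ k = 0 :=
    Nat.div_eq_of_lt (hk'.trans (Nat.lt_pow_self (by omega)))
  simp [this, digitSum]

/-- The residues generate `𝓀[K]`, so the map from `(ZMod p)^c` to `𝓀[K]` is onto. Both sides have `p
^ c` elements, so it is injective, and `n < p ^ c` is determined by its first `c` digits. -/
theorem IsResidueBasis.residue_digitSum_injOn {p : ℕ} [Fact p.Prime] [CharP K p] {c : ℕ}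
    {ε : Fin c → 𝒪[K]} (hε : IsResidueBasis p ε) {m n : ℕ} (hm : m < p ^ c) (hn : n < p ^ c)
    (h : IsLocalRing.residue 𝒪[K] (digitSum p ε m) = IsLocalRing.residue 𝒪[K] (digitSum p ε n)) :
    m = n := by
  have hp := (Fact.out : p.Prime)
  have : CharP 𝒪[K] p := inferInstance
  have : CharP 𝓀[K] p := by
    refine (CharP.charP_iff_prime_eq_zero hp).2 ?_
    rw [← map_natCast (IsLocalRing.residue 𝒪[K]), CharP.cast_eq_zero, map_zero]
  let : Algebra (ZMod p) 𝓀[K] := ZMod.algebra _ p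
  let g : (Fin c → ZMod p) →ₗ[ZMod p] 𝓀[K] :=
    Fintype.linearCombination (ZMod p) fun i => IsLocalRing.residue 𝒪[K] (ε i)
  have hsurj : Function.Surjective g := by
    have : g.toAddMonoidHom.range = ⊤ := by
      rw [eq_top_iff, ← hε.span_eq, AddSubgroup.closure_le]
      rintro _ ⟨i, rfl⟩
      exact ⟨Pi.single i 1, by simp [g, Fintype.linearCombination_apply_single]⟩
    exact AddMonoidHom.range_eq_top.1 this
  have : Finite 𝓀[K] := Finite.of_surjective g hsurj
  have : Fintype 𝓀[K] := Fintype.ofFinite _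
  have hbij : Function.Bijective g := by
    refine (Fintype.bijective_iff_surjective_and_card g).2 ⟨hsurj, ?_⟩
    rw [← Nat.card_eq_fintype_card (α := 𝓀[K]), ← resCard, hε.card_eq]
    simp [ZMod.card]
  have hg : ∀ n : ℕ, IsLocalRing.residue 𝒪[K] (digitSum p ε n) =
      g fun i => ((n / p ^ (i : ℕ) % p : ℕ) : ZMod p) := fun n => by
    simp only [g, Fintype.linearCombination_apply, digitSum, map_sum, map_mul, map_natCast,
      Algebra.smul_def]
  rw [hg, hg] at h
  have hdig := hbij.1 h
  refine eq_of_digits_eq hp.two_le fun k => ?_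
  by_cases hk : k < c
  · have := congrFun hdig ⟨k, hk⟩
    simpa [ZMod.natCast_eq_natCast_iff'] using this
  · have hle : p ^ c ≤ p ^ k := Nat.pow_le_pow_right hp.pos (by omega)
    rw [Nat.div_eq_of_lt (hm.trans_le hle), Nat.div_eq_of_lt (hn.trans_le hle)]

theorem one_lt_valuation_u_sub {p : ℕ} [Fact p.Prime] [CharP K p] {c : ℕ}
    {ε : Fin c → 𝒪[K]} (hε : IsResidueBasis p ε) {ϖ : K} (hϖ0 : ϖ ≠ 0) (hϖ : valuation K ϖ < 1)
    {m n : ℕ} (hmn : m ≠ n) : 1 < valuation K (u p ε ϖ m - u p ε ϖ n) := by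
  have hp := (Fact.out : p.Prime)
  have hq : 2 ≤ resCard K := by
    have : 1 < Nat.card 𝓀[K] := by
      have : Finite 𝓀[K] := Nat.finite_of_card_ne_zero (by
        have := hε.card_eq
        rw [resCard] at this
        rw [this]
        exact pow_ne_zero _ hp.ne_zero)
      exact Finite.one_lt_card
    exact this
  have key : ∀ k, digitSum p ε (m / resCard K ^ k % resCard K) ≠
      digitSum p ε (n / resCard K ^ k % resCard K) →
      valuation K ((digitSum p ε (m / resCard K ^ k % resCard K) : K) -
      digitSum p ε (n / resCard K ^ k % resCard K)) = 1 := fun k hk =>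
    valuation_sub_eq_one_of_residue_ne fun h => hk (congrArg _ (hε.residue_digitSum_injOn
      (hε.card_eq ▸ Nat.mod_lt _ (by omega)) (hε.card_eq ▸ Nat.mod_lt _ (by omega)) h))
  -- A common length lets the two expansions be subtracted digit by digit.
  set M := max m n + 1
  rw [u_eq_sum p ε ϖ hq (show m < M by omega), u_eq_sum p ε ϖ hq (show n < M by omega),
    ← Finset.sum_sub_distrib]
  simp only [← sub_mul]
  refine (one_lt_valuation_sum hϖ0 hϖ (fun k => ?_) M).2.resolve_left fun h => hmn ?_
  · by_cases hk : digitSum p ε (m / resCard K ^ k % resCard K) =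
        digitSum p ε (n / resCard K ^ k % resCard K)
    · exact Or.inl (by rw [hk, sub_self])
    · exact Or.inr (key k hk)
  · refine eq_of_digits_eq hq fun k => ?_
    by_cases hk : k < M
    · have h0 := h k hk
      by_contra hne
      have : digitSum p ε (m / resCard K ^ k % resCard K) =
        digitSum p ε (n / resCard K ^ k % resCard K) := Subtype.ext (sub_eq_zero.1 h0)
      exact hne (hε.residue_digitSum_injOn
        (hε.card_eq ▸ Nat.mod_lt _ (by omega)) (hε.card_eq ▸ Nat.mod_lt _ (by omega))
        (congrArg _ this))
    · have hlt : M ≤ k := not_lt.1 hk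
      have hk' : k < resCard K ^ k := Nat.lt_pow_self (by omega)
      rw [Nat.div_eq_of_lt (by omega), Nat.div_eq_of_lt (by omega)]

end Field

/-! ### Hilbert space estimates. -/

section Abstract

/-- Transfers the lower frame bound from the set of distinct elements to the indexed family. -/
theorem tsum_range_le {ι H : Type*} (e : ι → H) (g : H → ℝ≥0∞) :
    ∑' η : Set.range e, g η ≤ ∑' i, g (e i) := by
  have := ENNReal.tsum_comp_le_tsum_of_injective
    (Set.rangeSplitting_injective e) fun i => g (e i)
  simpa only [Set.apply_rangeSplitting] using this

variable {H : Type*} [NormedAddCommGroup H] [InnerProductSpace ℂ H]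

theorem _root_.Orthonormal.tsum_enorm_inner_sq_le {ι : Type*} {v : ι → H} (hv : Orthonormal ℂ v)
    (x : H) : ∑' i, ‖inner ℂ (v i) x‖ₑ ^ 2 ≤ ‖x‖ₑ ^ 2 := by
  rw [ENNReal.tsum_eq_iSup_sum]
  refine iSup_le fun s => ?_
  have h := hv.sum_inner_products_le x (s := s)
  have h' := ENNReal.ofReal_le_ofReal h
  rw [ENNReal.ofReal_sum_of_nonneg fun i _ => by positivity] at h'
  simpa only [ENNReal.ofReal_pow (norm_nonneg _), ofReal_norm] using h'

/-- Taking `f = e i` and keeping one term gives `‖e i‖⁴ ≤ B ‖e i‖²`. -/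
theorem enorm_sq_le_of_tsum_inner_le {ι : Type*} {e : ι → H} {B : ℝ≥0}
    (hB : ∀ f : H, ∑' i, ‖inner ℂ f (e i)‖ₑ ^ 2 ≤ (B : ℝ≥0∞) * ‖f‖ₑ ^ 2) (i : ι) :
    ‖e i‖ₑ ^ 2 ≤ B := by
  have h := (ENNReal.le_tsum i).trans (hB (e i))
  rcases eq_or_ne (e i) 0 with h0 | h0
  · simp [h0]
  have h1 : ‖inner ℂ (e i) (e i)‖ₑ = ‖e i‖ₑ ^ 2 := by
    rw [← ofReal_norm, inner_self_eq_norm_sq_to_K, ← ofReal_norm, ← ENNReal.ofReal_pow (norm_nonneg _)]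
    simp
  rw [h1, sq (‖e i‖ₑ ^ 2)] at h
  exact (ENNReal.mul_le_mul_iff_left (by simpa using h0) (by simp)).1 h

/-- If `V` preserves inner products up to the factor `κ` and sends `h` to a multiple of `h₀`, then
the inner product of `h₀` with `a • V ψ` is determined by that of `h` with `ψ` after normalization. -/
theorem norm_inner_smul_of_inner_map {V : H → H} {κ : ℝ} (hκ : 0 ≤ κ)
    (hV : ∀ x y, inner ℂ (V x) (V y) = (κ : ℂ) * inner ℂ x y) {h h₀ : H} {C : ℂ} (hC : C ≠ 0)
    (hh : V h = C • h₀) (hh₀ : h₀ ≠ 0) (a : ℂ) (ψ : H) :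
    h ≠ 0 ∧ ‖inner ℂ h₀ (a • V ψ)‖ =
      ‖a • V ψ‖ * ‖h₀‖ * ‖inner ℂ ((‖h‖⁻¹ : ℂ) • h) ((‖ψ‖⁻¹ : ℂ) • ψ)‖ := by
  have hn : ∀ x, ‖V x‖ = √κ * ‖x‖ := fun x => by
    rw [@norm_eq_sqrt_re_inner ℂ, hV, inner_self_eq_norm_sq_to_K]
    nth_rewrite 2 [← Real.sqrt_sq (norm_nonneg x)]
    rw [← Real.sqrt_mul hκ]
    congr 1
    have : (κ : ℂ) * ((‖x‖ : ℝ) : ℂ) ^ 2 = ((κ * ‖x‖ ^ 2 : ℝ) : ℂ) := by push_cast; rfl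
    exact (congrArg Complex.re this).trans (Complex.ofReal_re _)
  have hVh : √κ * ‖h‖ = ‖C‖ * ‖h₀‖ := by rw [← hn, hh, norm_smul]
  have hC' : 0 < ‖C‖ := norm_pos_iff.2 hC
  have hpos : 0 < ‖C‖ * ‖h₀‖ := mul_pos hC' (norm_pos_iff.2 hh₀)
  have hh0 : ‖h‖ ≠ 0 := fun h0 => by rw [h0, mul_zero] at hVh; exact hpos.ne hVh
  refine ⟨norm_ne_zero_iff.1 hh0, ?_⟩
  have h1 : ‖C‖ * ‖inner ℂ h₀ (V ψ)‖ = κ * ‖inner ℂ h ψ‖ := by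
    have := congrArg norm (hV h ψ)
    rwa [hh, inner_smul_left, norm_mul, norm_mul, RCLike.norm_conj, Complex.norm_real,
      Real.norm_of_nonneg hκ] at this
  rcases eq_or_ne ψ 0 with rfl | hψ
  -- `V` is not assumed linear, so the vanishing is read off `h1`.
  · have : ‖inner ℂ h₀ (V 0)‖ = 0 := by
      simpa [hC'.ne', hC] using h1
    rw [inner_smul_right, norm_mul, this]
    simp
  have hψ' : ‖ψ‖ ≠ 0 := norm_ne_zero_iff.2 hψ
  simp only [inner_smul_left, inner_smul_right, norm_mul, norm_smul, hn, RCLike.norm_conj,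
    norm_inv, Complex.norm_real, norm_norm]
  have hC0 := hC'.ne'
  have h2 : ‖inner ℂ h₀ (V ψ)‖ = √κ * ‖h₀‖ * ‖h‖⁻¹ * ‖inner ℂ h ψ‖ := by
    apply mul_left_cancel₀ hC0
    rw [h1]
    calc κ * ‖inner ℂ h ψ‖ = (√κ * ‖h‖) * √κ * ‖h‖⁻¹ * ‖inner ℂ h ψ‖ := by
          nth_rewrite 1 [← Real.mul_self_sqrt hκ]; field_simp
      _ = _ := by rw [hVh]; ring
  rw [h2]
  field_simp

end Abstract

/-! ### Mean-zero bumps and their orthogonality. -/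

section Wave

variable {K : Type*} [Field K] [ValuativeRel K]

/-- The Haar-type wavelet `1_B - 1_{r + B}` with `B = {x | |x| < |r|}`. -/
noncomputable def wave (r x : K) : ℂ :=
  Set.indicator {y : K | valuation K y < valuation K r} 1 x -
    Set.indicator {y : K | valuation K y < valuation K r} 1 (x - r)

theorem conj_wave (r x : K) : (starRingEnd ℂ) (wave r x) = wave r x := by
  classical
  simp [wave, Set.indicator_apply, apply_ite (starRingEnd ℂ)]

theorem wave_add (r x : K) {z : K} (hz : valuation K z < valuation K r) :
    wave r (x + z) = wave r x := by
  classical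
  have h : ∀ x, valuation K (x + z) < valuation K r ↔ valuation K x < valuation K r := fun x =>
    ⟨fun hx => by simpa using Valuation.map_sub_lt _ hx hz, fun hx => Valuation.map_add_lt _ hx hz⟩
  simp only [wave, Set.indicator_apply, Set.mem_ofPred_eq, h, add_sub_right_comm x z r, Pi.one_apply]

theorem wave_eq_zero {r x : K} (h : valuation K r < valuation K x) : wave r x = 0 := by
  classical
  have h' : valuation K (x - r) = valuation K x := Valuation.map_sub_eq_of_lt_left _ h
  simp [wave, h', not_lt.2 h.le]

variable [TopologicalSpace K] [IsNonarchimedeanLocalField K]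

theorem isOpen_valuation_lt (r : K) : IsOpen {y : K | valuation K y < valuation K r} := by
  simpa [Valuation.restrict_lt_iff] using
    Valuation.isOpen_ball (v := valuation K) ((valuation K).restrict r)

variable [MeasurableSpace K] [BorelSpace K]

theorem measurePreserving_sub (s : K) : MeasurePreserving (fun x => x - s) (haar K) (haar K) :=
  measurePreserving_sub_right (haar K) s

theorem memLp_indicator_valuation_lt (p : ℝ≥0∞) (r : K) :
    MemLp (Set.indicator {y : K | valuation K y < valuation K r} (1 : K → ℂ)) p (haar K) := by
  refine memLp_indicator_const p (isOpen_valuation_lt r).measurableSet 1 (Or.inr ?_)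
  refine ((measure_mono fun y hy => ?_).trans_lt (IsCompact.measure_lt_top (μ := haar K)
    (IsNonarchimedeanLocalField.isCompact_closedBall K (valuation K r)))).ne
  have hy' : valuation K y < valuation K r := hy
  exact hy'.le

theorem memLp_wave (r : K) : MemLp (wave r) 2 (haar K) :=
  (memLp_indicator_valuation_lt 2 r).sub
    ((memLp_indicator_valuation_lt 2 r).comp_measurePreserving (measurePreserving_sub r))

theorem memLp_wave_comp (r s : K) {a : K} (ha : a ≠ 0) :
    MemLp (fun x => wave r (a * x - s)) 2 (haar K) :=
  memLp_comp_mul_left ha (f := fun x => wave r (x - s))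
    ((memLp_wave r).comp_measurePreserving (measurePreserving_sub s))

theorem exists_map_mul_left_eq_smul {a : K} (ha : a ≠ 0) :
    MeasurableEmbedding (fun x : K => a * x) ∧
    ∃ κ : ℝ≥0, κ ≠ 0 ∧ Measure.map (fun x : K => a * x) (haar K) = κ • haar K := by
  have hcont : Continuous fun x : K => a * x := continuous_const_mul a
  have hcont' : Continuous fun x : K => a⁻¹ * x := continuous_const_mul a⁻¹
  let φ : K ≃ₜ+ K :=
    { toFun := fun x => a * x
      invFun := fun x => a⁻¹ * x
      left_inv := fun x => by simp [ha]
      right_inv := fun x => by simp [ha]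
      map_add' := fun x y => mul_add a x y
      continuous_toFun := hcont
      continuous_invFun := hcont' }
  refine ⟨φ.toHomeomorph.measurableEmbedding, ?_⟩
  have hreg : (Measure.map (fun x : K => a * x) (haar K)).Regular :=
    Measure.Regular.map φ.toHomeomorph
  have hhaar : (Measure.map (fun x : K => a * x) (haar K)).IsAddHaarMeasure :=
    φ.isAddHaarMeasure_map (haar K)
  have h := Measure.isAddLeftInvariant_eq_smul_of_regular
    (Measure.map (fun x : K => a * x) (haar K)) (haar K)
  refine ⟨_, fun h0 => ?_, h⟩
  rw [h0, zero_smul] at h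
  exact NeZero.ne (Measure.map (fun x : K => a * x) (haar K)) h

theorem quasiMeasurePreserving_mul_left {a : K} (ha : a ≠ 0) :
    Measure.QuasiMeasurePreserving (fun x : K => a * x) (haar K) (haar K) := by
  obtain ⟨he, κ, -, h⟩ := exists_map_mul_left_eq_smul ha
  exact ⟨he.measurable, h ▸ Measure.smul_absolutelyContinuous⟩

theorem integral_wave_comp (r s : K) {a : K} (ha : a ≠ 0) :
    ∫ x, wave r (a * x - s) ∂haar K = 0 := by
  set F : K → ℂ := fun x =>
    Set.indicator {y : K | valuation K y < valuation K r} 1 (a * x - s)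
  have hF : Integrable F (haar K) := by
    have h1 : Integrable (fun x => Set.indicator {y : K | valuation K y < valuation K r}
        (1 : K → ℂ) (x - s)) (haar K) := memLp_one_iff_integrable.1
      ((memLp_indicator_valuation_lt 1 r).comp_measurePreserving (measurePreserving_sub s))
    obtain ⟨he, κ, -, h⟩ := exists_map_mul_left_eq_smul ha
    have h2 : Integrable (fun x => Set.indicator {y : K | valuation K y < valuation K r}
        (1 : K → ℂ) (x - s)) (Measure.map (fun x : K => a * x) (haar K)) := by
      rw [h]; exact h1.smul_measure_nnreal
    exact (he.integrable_map_iff).1 h2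
  -- A difference of a function and its translate integrates to zero.
  have hw : ∀ x, wave r (a * x - s) = F x - F (x - a⁻¹ * r) := fun x => by
    simp only [wave, F]
    congr 2
    field_simp
    ring
  simp_rw [hw]
  rw [integral_sub hF (hF.comp_sub_right _), integral_sub_right_eq_self F, sub_self]

/-- The element of `L²(K)` given by `x ↦ wave r (a x - s)`. -/
noncomputable def waveLp (r s : K) {a : K} (ha : a ≠ 0) : L2 K :=
  (memLp_wave_comp r s ha).toLp _

theorem inner_waveLp (r s s' : K) {a a' : K} (ha : a ≠ 0) (ha' : a' ≠ 0) :
    inner ℂ (waveLp r s ha) (waveLp r s' ha') =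
      ∫ x, wave r (a' * x - s') * wave r (a * x - s) ∂haar K := by
  rw [L2.inner_def]
  refine integral_congr_ae ?_
  filter_upwards [(memLp_wave_comp r s ha).coeFn_toLp,
    (memLp_wave_comp r s' ha').coeFn_toLp] with x h1 h2
  rw [waveLp, waveLp, h1, h2, RCLike.inner_apply, conj_wave]

/-- If both factors were nonzero at `x`, then `a x` would be within `|r|` of both `s` and `s'`. -/
theorem inner_waveLp_of_lt_sub {r s s' : K} (h : valuation K r < valuation K (s - s')) {a : K}
    (ha : a ≠ 0) : inner ℂ (waveLp r s ha) (waveLp r s' ha) = 0 := by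
  rw [inner_waveLp]
  refine integral_eq_zero_of_ae (ae_of_all _ fun x => ?_)
  by_contra hne
  rcases not_or.1 (mul_eq_zero.not.1 hne) with ⟨h1, h2⟩
  have h1' := not_lt.1 (mt wave_eq_zero h1)
  have h2' := not_lt.1 (mt wave_eq_zero h2)
  have := Valuation.map_sub_le (valuation K) h2' h1'
  rw [sub_sub_sub_cancel_left, Valuation.map_sub_swap] at this
  exact absurd h (not_lt.2 this)

theorem inner_waveLp_of_lt (r s s' : K) (hr : r ≠ 0) {a a' : K} (ha : a ≠ 0) (ha' : a' ≠ 0)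
    (h : valuation K a' < valuation K a) :
    inner ℂ (waveLp r s ha) (waveLp r s' ha') = 0 := by
  -- On the support of the finer bump, `a' x` differs from `a' / a * s` by less than `|r|`, so the
  -- coarser bump keeps its value there.
  have hx : ∀ x, wave r (a' * x - s') * wave r (a * x - s) =
      wave r (a' / a * s - s') * wave r (a * x - s) := fun x => by
    rcases lt_or_ge (valuation K r) (valuation K (a * x - s)) with h1 | h1
    · rw [wave_eq_zero h1, mul_zero, mul_zero]
    · have heq : a' * x - s' = (a' / a * s - s') + a' / a * (a * x - s) := by
        field_simp
        ring
      rw [heq, wave_add]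
      have hlt : valuation K (a' / a) < 1 := by
        rw [map_div₀]
        exact (div_lt_one₀ (by simpa [zero_lt_iff] using ha)).2 h
      have hr' : 0 < valuation K r := by simpa [zero_lt_iff] using hr
      rw [map_mul]
      calc _ ≤ valuation K (a' / a) * valuation K r := by gcongr
        _ < 1 * valuation K r := by gcongr
        _ = _ := one_mul _
  rw [inner_waveLp]
  simp_rw [hx]
  rw [integral_const_mul, integral_wave_comp r s ha, mul_zero]

theorem waveLp_ne_zero {r : K} (hr : r ≠ 0) : waveLp r 0 (one_ne_zero (α := K)) ≠ 0 := by
  intro h0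
  have h1 : waveLp r 0 (one_ne_zero (α := K)) =ᵐ[haar K] fun x => wave r (1 * x - 0) :=
    (memLp_wave_comp r 0 one_ne_zero).coeFn_toLp
  rw [h0] at h1
  have h2 := h1.symm.trans (Lp.coeFn_zero ℂ 2 (haar K))
  have hpos : 0 < haar K {y : K | valuation K y < valuation K r} :=
    (isOpen_valuation_lt r).measure_pos _ ⟨0, by simpa [zero_lt_iff] using hr⟩
  refine hpos.ne' (measure_mono_null (fun x hx => ?_) h2)
  have h3 : valuation K (x - r) = valuation K r := Valuation.map_sub_eq_of_lt_right _ hx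
  have hx' : valuation K x < valuation K r := hx
  simp [wave, h3, hx']

/-! ### Translations and dilations acting on the bumps. -/

theorem inner_translation (y : K) (f g : L2 K) :
    inner ℂ (translation y f) (translation y g) = inner ℂ f g :=
  (Lp.compMeasurePreservingₗᵢ ℂ (fun x : K => x - y) (measurePreserving_sub y)).inner_map_map f g

theorem translation_smul (y : K) (c : ℂ) (f : L2 K) :
    translation y (c • f) = c • translation y f :=
  (Lp.compMeasurePreservingₗᵢ ℂ (fun x : K => x - y) (measurePreserving_sub y)).map_smul c f

/-- The value of `κ` is left open, since it cancels once vectors are normalized. -/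
theorem exists_inner_dilation {ϖ : K} (hϖ : IsPrimeElement ϖ) (j : ℤ) :
    ∃ κ : ℝ, 0 ≤ κ ∧ ∀ f g : L2 K,
      inner ℂ (dilation hϖ j f) (dilation hϖ j g) = (κ : ℂ) * inner ℂ f g := by
  obtain ⟨he, κ, -, h⟩ := exists_map_mul_left_eq_smul (zpow_ne_zero (-j) hϖ.ne_zero)
  set C : ℝ := (resCard K : ℝ) ^ ((j : ℝ) / 2)
  refine ⟨C * C * κ, by positivity, fun f g => ?_⟩
  have h1 : inner ℂ (dilation hϖ j f) (dilation hϖ j g) =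
      ∫ x, ((C : ℂ) * C) * inner ℂ (f (ϖ ^ (-j) * x)) (g (ϖ ^ (-j) * x)) ∂haar K := by
    rw [L2.inner_def]
    refine integral_congr_ae ?_
    filter_upwards [(memLp_dilation hϖ j f).coeFn_toLp,
      (memLp_dilation hϖ j g).coeFn_toLp] with x h1 h2
    rw [dilation, dilation, h1, h2]
    simp only [RCLike.inner_apply, map_mul, Complex.conj_ofReal]
    ring
  rw [h1, integral_const_mul, ← he.integral_map (fun x => inner ℂ (f x) (g x)), h,
    integral_smul_nnreal_measure, L2.inner_def]
  simp only [NNReal.smul_def, Complex.real_smul]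
  push_cast
  ring

theorem translation_dilation_waveLp {ϖ : K} (hϖ : IsPrimeElement ϖ) (j : ℤ) (y r t : K) :
    translation y (dilation hϖ j (waveLp r (t - y) (zpow_ne_zero j hϖ.ne_zero))) =
      (((resCard K : ℝ) ^ ((j : ℝ) / 2) : ℝ) : ℂ) • waveLp r t (one_ne_zero (α := K)) := by
  have h1 : dilation hϖ j (waveLp r (t - y) (zpow_ne_zero j hϖ.ne_zero)) =
      (((resCard K : ℝ) ^ ((j : ℝ) / 2) : ℝ) : ℂ) •
        waveLp r (t - y) (one_ne_zero (α := K)) := by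
    rw [waveLp, waveLp, ← MemLp.toLp_const_smul, dilation]
    refine MemLp.toLp_congr _ _ ?_
    have hae := (quasiMeasurePreserving_mul_left (zpow_ne_zero (-j) hϖ.ne_zero)).ae
      (memLp_wave_comp r (t - y) (zpow_ne_zero j hϖ.ne_zero)).coeFn_toLp
    filter_upwards [hae] with x hx
    rw [hx, ← mul_assoc, ← zpow_add₀ hϖ.ne_zero]
    simp
  rw [h1, translation_smul]
  congr 1
  rw [translation, waveLp, Lp.toLp_compMeasurePreserving, waveLp]
  refine MemLp.toLp_congr _ _ (ae_of_all _ fun x => ?_)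
  simp only [Function.comp_apply]
  congr 1
  ring

theorem norm_waveLp_one (r t : K) :
    ‖waveLp r t (one_ne_zero (α := K))‖ = ‖waveLp r 0 (one_ne_zero (α := K))‖ := by
  have h : translation t (waveLp r 0 (one_ne_zero (α := K))) = waveLp r t one_ne_zero := by
    rw [translation, waveLp, Lp.toLp_compMeasurePreserving, waveLp]
    refine MemLp.toLp_congr _ _ (ae_of_all _ fun x => ?_)
    simp
  rw [← h]
  exact (Lp.compMeasurePreservingₗᵢ ℂ (fun x : K => x - t) (measurePreserving_sub t)).norm_map _

end Wave

/-! ### Orthonormality of the pulled-back bumps and the failure of the lower bound. -/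

section Frame

variable {K : Type*} [Field K] [ValuativeRel K] [TopologicalSpace K]
  [IsNonarchimedeanLocalField K]

/-- For `k = k'` the distance is the larger of `|ϖ ^ t|` and `|ϖ ^ t'|`, with both exponents below
`N`. Otherwise `|u(k) - u(k')| > 1` dominates. -/
theorem valuation_pow_lt_sub {p : ℕ} [Fact p.Prime] [CharP K p] {c : ℕ} {ε : Fin c → 𝒪[K]}
    (hε : IsResidueBasis p ε) {ϖ : K} (hϖ : IsPrimeElement ϖ) {N : ℕ} {t t' : Fin N} {k k' : ℕ}
    (h : (t, k) ≠ (t', k')) :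
    valuation K (ϖ ^ N) <
      valuation K ((ϖ ^ (t : ℕ) - u p ε ϖ k) - (ϖ ^ (t' : ℕ) - u p ε ϖ k')) := by
  have hpos : 0 < valuation K ϖ := by simpa [zero_lt_iff] using hϖ.ne_zero
  have hle : ∀ n : ℕ, valuation K (ϖ ^ n) ≤ 1 := fun n => by
    rw [map_pow]; exact pow_le_one₀ hpos.le hϖ.1.le
  have hlt : ∀ {m n : ℕ}, m < n → valuation K (ϖ ^ n) < valuation K (ϖ ^ m) := fun hmn => by
    simpa only [map_pow] using pow_lt_pow_right_of_lt_one₀ hpos hϖ.1 hmn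
  by_cases hk : k = k'
  · subst hk
    rw [sub_sub_sub_cancel_right]
    have ht : (t : ℕ) ≠ t' := fun ht => h (by rw [Fin.ext ht])
    rcases lt_or_gt_of_ne ht with ht | ht
    · rw [Valuation.map_sub_eq_of_lt_left _ (hlt ht)]
      exact hlt t.2
    · rw [Valuation.map_sub_eq_of_lt_right _ (hlt ht)]
      exact hlt t'.2
  · have hu := one_lt_valuation_u_sub hε hϖ.ne_zero hϖ.1 hk
    have hd : valuation K (ϖ ^ (t : ℕ) - ϖ ^ (t' : ℕ)) <
        valuation K (u p ε ϖ k - u p ε ϖ k') :=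
      ((valuation K).map_sub_le (hle _) (hle _)).trans_lt hu
    rw [sub_sub_sub_comm, Valuation.map_sub_eq_of_lt_right _ hd]
    exact (hle N).trans_lt hu

variable [MeasurableSpace K] [BorelSpace K]

theorem inner_waveLp_zpow_of_ne {ϖ : K} (hϖ : IsPrimeElement ϖ) {r : K} (hr : r ≠ 0) (s s' : K)
    {j j' : ℤ} (h : j ≠ j') :
    inner ℂ (waveLp r s (zpow_ne_zero j hϖ.ne_zero))
      (waveLp r s' (zpow_ne_zero j' hϖ.ne_zero)) = 0 := by
  have hpos : 0 < valuation K ϖ := by simpa [zero_lt_iff] using hϖ.ne_zero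
  have hlt : ∀ {i i' : ℤ}, i < i' → valuation K (ϖ ^ i') < valuation K (ϖ ^ i) := fun hi => by
    simpa only [map_zpow₀] using zpow_lt_zpow_right_of_lt_one₀ hpos hϖ.1 hi
  rcases lt_or_gt_of_ne h with h | h
  · exact inner_waveLp_of_lt r s s' hr _ _ (hlt h)
  · rw [← inner_conj_symm, inner_waveLp_of_lt r s' s hr _ _ (hlt h), map_zero]

/-- The `L²`-normalized wavelets `x ↦ wave (ϖ ^ N) (ϖ ^ j x - (ϖ ^ t - u(k)))`, where `t < N`. -/
noncomputable def waveFamily (p : ℕ) {c : ℕ} (ε : Fin c → 𝒪[K]) {ϖ : K} (hϖ : IsPrimeElement ϖ)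
    (N : ℕ) (i : Fin N × ℤ × ℕ) : L2 K :=
  (‖waveLp (ϖ ^ N) (ϖ ^ (i.1 : ℕ) - u p ε ϖ i.2.2) (zpow_ne_zero i.2.1 hϖ.ne_zero)‖⁻¹ : ℂ) •
    waveLp (ϖ ^ N) (ϖ ^ (i.1 : ℕ) - u p ε ϖ i.2.2) (zpow_ne_zero i.2.1 hϖ.ne_zero)

theorem waveLp_one_ne_zero {r : K} (hr : r ≠ 0) (t : K) :
    waveLp r t (one_ne_zero (α := K)) ≠ 0 := by
  rw [← norm_ne_zero_iff, norm_waveLp_one]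
  exact norm_ne_zero_iff.2 (waveLp_ne_zero hr)

theorem norm_inner_waveLp_coaffineSystem {p : ℕ} [Fact p.Prime] {c : ℕ}
    {ε : Fin c → 𝒪[K]} (hε : IsResidueBasis p ε) {ϖ : K} (hϖ : IsPrimeElement ϖ) {L : ℕ}
    (ψ : Fin L → L2 K) (w : Fin L → ℤ → ℂ) {N : ℕ} (t : Fin N) (l : Fin L) (j : ℤ) (k : ℕ) :
    waveLp (ϖ ^ N) (ϖ ^ (t : ℕ) - u p ε ϖ k) (zpow_ne_zero j hϖ.ne_zero) ≠ 0 ∧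
    ‖inner ℂ (waveLp (ϖ ^ N) (ϖ ^ (t : ℕ)) one_ne_zero) (coaffineSystem p ε hϖ ψ w (l, j, k))‖ =
      ‖coaffineSystem p ε hϖ ψ w (l, j, k)‖ *
        ‖waveLp (ϖ ^ N) (ϖ ^ (t : ℕ)) (one_ne_zero (α := K))‖ *
        ‖inner ℂ (waveFamily p ε hϖ N (t, j, k)) ((‖ψ l‖⁻¹ : ℂ) • ψ l)‖ := by
  obtain ⟨κ, hκ, hV⟩ := exists_inner_dilation hϖ j
  have hq : 0 < (resCard K : ℝ) := by
    rw [hε.card_eq]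
    exact_mod_cast pow_pos (Fact.out : p.Prime).pos c
  exact norm_inner_smul_of_inner_map
    (V := fun f => translation (u p ε ϖ k) (dilation hϖ j f)) hκ
    (fun x y => by rw [inner_translation, hV])
    (Complex.ofReal_ne_zero.2 (Real.rpow_pos_of_pos hq _).ne')
    (translation_dilation_waveLp hϖ j (u p ε ϖ k) (ϖ ^ N) (ϖ ^ (t : ℕ)))
    (waveLp_one_ne_zero (pow_ne_zero N hϖ.ne_zero) _) (w l j) (ψ l)

theorem orthonormal_waveFamily {p : ℕ} [Fact p.Prime] [CharP K p] {c : ℕ} {ε : Fin c → 𝒪[K]}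
    (hε : IsResidueBasis p ε) {ϖ : K} (hϖ : IsPrimeElement ϖ) (N : ℕ) :
    Orthonormal ℂ (waveFamily p ε hϖ N) := by
  refine ⟨fun ⟨t, j, k⟩ => ?_, fun ⟨t, j, k⟩ ⟨t', j', k'⟩ h => ?_⟩
  -- Only the nonvanishing of the bump is needed, so a zero system serves.
  · have h := (norm_inner_waveLp_coaffineSystem hε hϖ (fun _ : Fin 1 => 0) 0 t 0 j k).1
    exact norm_smul_inv_norm (𝕜 := ℂ) h
  · have hr : ϖ ^ N ≠ 0 := pow_ne_zero N hϖ.ne_zero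
    simp only [waveFamily, inner_smul_left, inner_smul_right]
    refine mul_eq_zero_of_right _ (mul_eq_zero_of_right _ ?_)
    by_cases hj : j = j'
    · subst hj
      refine inner_waveLp_of_lt_sub (valuation_pow_lt_sub hε hϖ fun he => h ?_) _
      simp only [Prod.mk.injEq] at he ⊢
      exact ⟨he.1, trivial, he.2⟩
    · exact inner_waveLp_zpow_of_ne hϖ hr _ _ hj

/-- The bound has no factor `N`, because a single use of Bessel's inequality for each `l` covers all
`t` together. -/
theorem sum_tsum_inner_coaffineSystem_le {p : ℕ} [Fact p.Prime] [CharP K p] {c : ℕ}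
    {ε : Fin c → 𝒪[K]} (hε : IsResidueBasis p ε) {ϖ : K} (hϖ : IsPrimeElement ϖ) {L : ℕ}
    (ψ : Fin L → L2 K) (w : Fin L → ℤ → ℂ) {B : ℝ≥0}
    (hB : ∀ i, ‖coaffineSystem p ε hϖ ψ w i‖ₑ ^ 2 ≤ B) (N : ℕ) :
    ∑ t : Fin N, ∑' i, ‖inner ℂ (waveLp (ϖ ^ N) (ϖ ^ (t : ℕ)) one_ne_zero)
      (coaffineSystem p ε hϖ ψ w i)‖ₑ ^ 2 ≤
    L * (B * ‖waveLp (ϖ ^ N) 0 (one_ne_zero (α := K))‖ₑ ^ 2) := by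
  set η := ‖waveLp (ϖ ^ N) 0 (one_ne_zero (α := K))‖ₑ
  set φ : Fin L → L2 K := fun l => (‖ψ l‖⁻¹ : ℂ) • ψ l
  have hφ : ∀ l, ‖φ l‖ₑ ^ 2 ≤ 1 := fun l => by
    -- Only an inequality: `φ l = 0` when `ψ l = 0`.
    have : ‖φ l‖ ≤ 1 := by
      simp only [φ, norm_smul, norm_inv, Complex.norm_real, norm_norm]
      exact inv_mul_le_one
    rw [← ofReal_norm]
    exact pow_le_one₀ zero_le (ENNReal.ofReal_le_one.2 this)
  have hterm : ∀ (t : Fin N) (l : Fin L) (jk : ℤ × ℕ),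
      ‖inner ℂ (waveLp (ϖ ^ N) (ϖ ^ (t : ℕ)) one_ne_zero)
        (coaffineSystem p ε hϖ ψ w (l, jk))‖ₑ ^ 2 ≤
      B * η ^ 2 * ‖inner ℂ (waveFamily p ε hϖ N (t, jk)) (φ l)‖ₑ ^ 2 := fun t l jk => by
    have h := (norm_inner_waveLp_coaffineSystem hε hϖ ψ w t l jk.1 jk.2).2
    rw [norm_waveLp_one] at h
    have h' := congrArg ENNReal.ofReal h
    rw [ENNReal.ofReal_mul (by positivity), ENNReal.ofReal_mul (by positivity)] at h'
    simp only [ofReal_norm] at h'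
    rw [h', mul_pow, mul_pow]
    gcongr
    exact hB _
  calc _ ≤ ∑ t : Fin N, ∑' (l : Fin L), ∑' (jk : ℤ × ℕ),
        B * η ^ 2 * ‖inner ℂ (waveFamily p ε hϖ N (t, jk)) (φ l)‖ₑ ^ 2 := by
        refine Finset.sum_le_sum fun t _ => ?_
        rw [ENNReal.tsum_prod']
        exact ENNReal.tsum_le_tsum fun l => ENNReal.tsum_le_tsum fun jk => hterm t l jk
    _ = ∑ l : Fin L, B * η ^ 2 * ∑' i, ‖inner ℂ (waveFamily p ε hϖ N i) (φ l)‖ₑ ^ 2 := by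
        simp only [tsum_fintype, ENNReal.tsum_mul_left, ENNReal.tsum_prod' (α := Fin N)]
        rw [Finset.sum_comm]
        simp only [Finset.mul_sum]
    _ ≤ ∑ l : Fin L, B * η ^ 2 := by
        refine Finset.sum_le_sum fun l _ => ?_
        calc _ ≤ B * η ^ 2 * 1 := by
              gcongr
              exact ((orthonormal_waveFamily hε hϖ N).tsum_enorm_inner_sq_le _).trans (hφ l)
          _ = _ := mul_one _
    _ = _ := by simp

theorem coaffineSystem_not_lower_bound {p : ℕ} [Fact p.Prime] [CharP K p] {c : ℕ}
    {ε : Fin c → 𝒪[K]} (hε : IsResidueBasis p ε) {ϖ : K} (hϖ : IsPrimeElement ϖ) {L : ℕ}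
    (ψ : Fin L → L2 K) (w : Fin L → ℤ → ℂ) {A B : ℝ≥0} (hA : 0 < A)
    (hB : ∀ i, ‖coaffineSystem p ε hϖ ψ w i‖ₑ ^ 2 ≤ B) :
    ¬ ∀ f : L2 K, (A : ℝ≥0∞) * ‖f‖ₑ ^ 2 ≤
      ∑' i, ‖inner ℂ f (coaffineSystem p ε hϖ ψ w i)‖ₑ ^ 2 := by
  intro hlow
  have key : ∀ N : ℕ, (N : ℝ≥0) * A ≤ L * B := fun N => by
    have hη : ‖waveLp (ϖ ^ N) 0 (one_ne_zero (α := K))‖ₑ ^ 2 ≠ 0 := by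
      simpa using waveLp_ne_zero (pow_ne_zero N hϖ.ne_zero)
    have h : ∑ _t : Fin N, (A : ℝ≥0∞) * ‖waveLp (ϖ ^ N) 0 (one_ne_zero (α := K))‖ₑ ^ 2 ≤ _ :=
      (Finset.sum_le_sum fun t _ => by
        have := hlow (waveLp (ϖ ^ N) (ϖ ^ (t : ℕ)) one_ne_zero)
        rwa [← ofReal_norm, norm_waveLp_one, ofReal_norm] at this).trans
      (sum_tsum_inner_coaffineSystem_le hε hϖ ψ w hB N)
    simp only [Finset.sum_const, Finset.card_univ, Fintype.card_fin, nsmul_eq_mul] at h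
    rw [← mul_assoc, ← mul_assoc, ENNReal.mul_le_mul_iff_left hη (by simp)] at h
    exact_mod_cast h
  obtain ⟨N, hN⟩ := exists_nat_gt ((L * B : ℝ≥0) / A)
  exact (key N).not_gt ((div_lt_iff₀ hA).1 hN)

end Frame
end LocalFieldFrames

theorem mainTheorem4 {K : Type*} [Field K] [ValuativeRel K] [TopologicalSpace K]
    [IsNonarchimedeanLocalField K] [MeasurableSpace K] [BorelSpace K]
    (p : ℕ) [Fact p.Prime] [CharP K p]
    {ϖ : K} (hϖ : LocalFieldFrames.IsPrimeElement ϖ)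
    {c : ℕ} (ε : Fin c → 𝒪[K]) (hε : LocalFieldFrames.IsResidueBasis p ε)
    (L : ℕ) (ψ : Fin L → LocalFieldFrames.L2 K) (w : Fin L → ℤ → ℂ) :
    ¬ LocalFieldFrames.IsFrame (LocalFieldFrames.coaffineSystem p ε hϖ ψ w) ∧
    ¬ LocalFieldFrames.IsFrame
      (fun η : Set.range (LocalFieldFrames.coaffineSystem p ε hϖ ψ w) =>
        (η : LocalFieldFrames.L2 K)) := by
  constructor
  · rintro ⟨A, B, hA, -, h⟩
    exact LocalFieldFrames.coaffineSystem_not_lower_bound hε hϖ ψ w hA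
      (LocalFieldFrames.enorm_sq_le_of_tsum_inner_le fun f => (h f).2) fun f => (h f).1
  -- Discarding repetitions does not affect the norm bound, and restoring them only increases the
  -- sum in the lower bound.
  · rintro ⟨A, B, hA, -, h⟩
    exact LocalFieldFrames.coaffineSystem_not_lower_bound hε hϖ ψ w hA
      (fun i => LocalFieldFrames.enorm_sq_le_of_tsum_inner_le (fun f => (h f).2) ⟨_, i, rfl⟩)
      fun f => (h f).1.trans (LocalFieldFrames.tsum_range_le _ fun x => ‖inner ℂ f x‖ₑ ^ 2)
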